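/- Let $K$ be a number field with ring of integers $\mathcal{O}$, let $\mathcal{V}$ be the set of places of $K$, and let $S\subset\mathcal{V}$ be any subset (finite or infinite). Let $\mathcal{O}[S]=\{x\in K : |x|_\nu\le 1 \text{ for all finite places } \nu\notin S\}$ be the ring of $S$-integers. Let $\mathbf{H}$ be a connected adjoint semisimple affine algebraic group over $K$, with a fixed embedding $\mathbf{H}<\mathbf{GL}_n$ over $K$, and put $\mathbf{H}(\mathcal{O}[S])=\mathbf{GL}_n(\mathcal{O}[S])\cap\mathbf{H}(K)$ and, for each finite place $\nu$ with completed valuation ring $\mathcal{O}_\nu\subset K_\nu$, $\mathbf{H}(\mathcal{O}_\nu)=\mathbf{GL}_n(\mathcal{O}_\nu)\cap\mathbf{H}(K_\nu)$. Let $$\mathbf{H}_S=\Bigl\{(x_\nu)\in\prod_{\nu\in S}\mathbf{H}(K_\nu) : x_\nu\in\mathbf{H}(\mathcal{O}_\nu)\text{ for all but finitely many finite places }\nu\in S\Bigr\}$$ and let $\mathbf{H}(K)\to\mathbf{H}_S$ be the diagonal homomorphism (which is injective if $S\neq\emptyset$). Assume that $\mathbf{H}(\mathcal{O}[S])$ is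 Zariski dense in $\mathbf{H}$. Then the commensurator in $\mathbf{H}_S$ of the diagonal image of $\mathbf{H}(\mathcal{O}[S])$, that is, the group of all $g\in\mathbf{H}_S$ such that this image $\Gamma$ and $g\Gamma g^{-1}$ are commensurable (their intersection has finite index in both), is exactly the diagonal image of $\mathbf{H}(K)$. -/

import Mathlib

open NumberField IsDedekindDomain
open scoped TensorProduct RestrictedProduct Topology

noncomputable section

namespace AlgGrp

/-!
An affine algebraic group `H` over a field `K` is given by its Hopf algebra `R = K[H]` of regular
functions, a commutative Hopf algebra of finite type over `K`.
-/

section Points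

variable (K R : Type*) [Field K] [CommRing R] [HopfAlgebra K R]

/-- The set `H(A) = Hom_{K-alg}(K[H], A)` of `A`-points of `H`; see below for its group structure. -/
@[ext]
structure Points (A : Type*) [CommRing A] [Algebra K A] where
  /-- The homomorphism of `K`-algebras `K[H] → A` underlying a point. -/
  hom : R →ₐ[K] A

variable {A B : Type*} [CommRing A] [Algebra K A] [CommRing B] [Algebra K B]

/-- The product of `x` and `y` is `m ∘ (x ⊗ y) ∘ Δ`. -/
instance : Mul (Points K R A) where
  mul x y := ⟨(Algebra.TensorProduct.lift x.hom y.hom (fun _ _ => Commute.all _ _)).comp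
    (Bialgebra.comulAlgHom K R)⟩

/-- The identity is the counit. -/
instance : One (Points K R A) where
  one := ⟨(Algebra.ofId K A).comp (Bialgebra.counitAlgHom K R)⟩

/-- The inverse of `x` is `x ∘ antipode`. -/
instance : Inv (Points K R A) where
  inv x := ⟨x.hom.comp (HopfAlgebra.antipodeAlgHom K R)⟩

variable {K R}

lemma Points.hom_one (c : R) :
    (1 : Points K R A).hom c = algebraMap K A (Coalgebra.counit c) := rfl

lemma Points.hom_mul (x y : Points K R A) (c : R) :
    (x * y).hom c =
      Algebra.TensorProduct.lift x.hom y.hom (fun _ _ => Commute.all _ _)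
        (Coalgebra.comul (R := K) c) := rfl

lemma Points.hom_inv (x : Points K R A) (c : R) :
    x⁻¹.hom c = x.hom (HopfAlgebra.antipode K c) := rfl

lemma Points.toConv_hom_mul (x y : Points K R A) :
    WithConv.toConv (x * y).hom = WithConv.toConv x.hom * WithConv.toConv y.hom := by
  apply WithConv.ext
  ext c
  rw [AlgHom.convMul_apply]
  rfl

lemma Points.toConv_hom_injective :
    Function.Injective (fun x : Points K R A => WithConv.toConv x.hom) := fun _ _ h =>
  Points.ext (WithConv.toConv_injective h)

variable (K R)

instance : Group (Points K R A) :=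
  Group.ofLeftAxioms
    (fun x y z => Points.toConv_hom_injective (by simp only [Points.toConv_hom_mul, mul_assoc]))
    (fun x => Points.toConv_hom_injective (by
      simp only [Points.toConv_hom_mul]
      exact one_mul (WithConv.toConv x.hom)))
    (fun x => Points.toConv_hom_injective (by
      have h := AlgHom.comp_convMul_distrib x.hom
        (WithConv.toConv (HopfAlgebra.antipodeAlgHom K R)) (WithConv.toConv (AlgHom.id K R))
      rw [AlgHom.antipode_id_cancel] at h
      simp only [Points.toConv_hom_mul]
      refine Eq.trans (congrArg WithConv.toConv h.symm) ?_
      apply WithConv.ext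
      ext c
      exact x.hom.commutes _))

/-- Functoriality: the homomorphism `H(A) → H(B)` induced by a `K`-algebra map `A → B`. -/
def Points.map (f : A →ₐ[K] B) : Points K R A →* Points K R B where
  toFun x := ⟨f.comp x.hom⟩
  map_one' := by
    ext c
    exact f.commutes _
  map_mul' x y := Points.toConv_hom_injective (by
    simp only [Points.toConv_hom_mul]
    refine Eq.trans ?_ (congrArg WithConv.toConv
      (AlgHom.comp_convMul_distrib f (WithConv.toConv x.hom) (WithConv.toConv y.hom)))
    rw [← Points.toConv_hom_mul])

/-- The homomorphism `H(K) → H(A)` coming from the structure map `K → A`. -/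
abbrev Points.ofBase (A : Type*) [CommRing A] [Algebra K A] : Points K R K →* Points K R A :=
  Points.map K R (Algebra.ofId K A)

end Points

section Geometric

variable (K R : Type*) [Field K] [CommRing R] [HopfAlgebra K R]

/-- The point of `Spec (L ⊗ K[H])` (the base change of `H` to `L`) defined by `x ∈ H(L)`. -/
def toSpec (L : Type*) [Field L] [Algebra K L] (x : Points K R L) : PrimeSpectrum (L ⊗[K] R) :=
  ⟨RingHom.ker (Algebra.TensorProduct.lift (Algebra.ofId L L) x.hom
    (fun _ _ => Commute.all _ _)), RingHom.ker_isPrime _⟩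

/-- The Zariski topology on the group `H(K̄)`: the closed sets are the zero loci in `H(K̄)` of families
of elements of `K̄[H] = K̄ ⊗ K[H]`. -/
@[reducible] def zariski : TopologicalSpace (Points K R (AlgebraicClosure K)) :=
  TopologicalSpace.induced (toSpec K R (AlgebraicClosure K)) inferInstance

/-- `H` is connected, i.e. `H(K̄)` is connected in the Zariski topology. -/
def IsConnectedGroup : Prop := @ConnectedSpace _ (zariski K R)

/-- `H` is semisimple: its radical is trivial, i.e. every Zariski closed, connected, solvable, normal
subgroup of `H(K̄)` is trivial. -/
def IsSemisimple : Prop :=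
  ∀ N : Subgroup (Points K R (AlgebraicClosure K)), N.Normal → Group.IsSolvable N →
    IsClosed[zariski K R] (N : Set (Points K R (AlgebraicClosure K))) →
    @IsConnected _ (zariski K R) (N : Set (Points K R (AlgebraicClosure K))) → N = ⊥

/-- `H`, assumed to be connected and semisimple, is adjoint: its center is trivial. (In characteristic
zero the center is smooth, so it is trivial as soon as the center of the group `H(K̄)` is.) -/
def IsAdjoint : Prop := Subgroup.center (Points K R (AlgebraicClosure K)) = ⊥

/-- A subset `X` of `H(K)` is Zariski dense in `H`. -/
def IsZariskiDense (X : Set (Points K R K)) : Prop :=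
  @Dense _ (zariski K R) (Points.ofBase K R (AlgebraicClosure K) '' X)

end Geometric

section Embedding

variable (K R : Type*) [Field K] [CommRing R] [HopfAlgebra K R]

/-- An embedding `H < GL_n` of algebraic groups over `K`, given by the matrix `u` of the restrictions
to `H` of the coordinate functions on `GL_n`. The first two conditions say that `u` defines a
homomorphism `H → GL_n`, the last one that the corresponding map `K[GL_n] → K[H]` is surjective
(`K[GL_n]` is generated by the entries of the generic matrix and of its inverse). -/
structure GLEmbedding (n : ℕ) where
  /-- The matrix of coordinate functions on `H`. -/
  u : Matrix (Fin n) (Fin n) R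
  comul_u : ∀ i j, Coalgebra.comul (R := K) (u i j) = ∑ k, u i k ⊗ₜ[K] u k j
  counit_u : ∀ i j, Coalgebra.counit (R := K) (u i j) = (1 : Matrix (Fin n) (Fin n) K) i j
  adjoin_eq_top : Algebra.adjoin K
    (Set.range (fun p : Fin n × Fin n => u p.1 p.2) ∪
      Set.range (fun p : Fin n × Fin n => HopfAlgebra.antipode K (u p.1 p.2))) = ⊤

variable {K R} {n : ℕ} (ι : GLEmbedding K R n)
variable (A : Type*) [CommRing A] [Algebra K A]

/-- The homomorphism from `H(A)` to the multiplicative monoid of matrices over `A`. -/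
def GLEmbedding.toMatrix : Points K R A →* Matrix (Fin n) (Fin n) A where
  toFun x := Matrix.of fun i j => x.hom (ι.u i j)
  map_one' := by
    ext i j
    rw [Matrix.of_apply, Points.hom_one, ι.counit_u, Matrix.one_apply, Matrix.one_apply]
    split_ifs <;> simp
  map_mul' x y := by
    ext i j
    rw [Matrix.of_apply, Points.hom_mul, Matrix.mul_apply]
    simp [ι.comul_u]

/-- The homomorphism `H(A) → GL_n(A)` induced by the embedding. -/
def GLEmbedding.toGL : Points K R A →* GL (Fin n) A := (ι.toMatrix A).toHomUnits

variable {A}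

/-- For a subring `B` of a `K`-algebra `A`, the subgroup `H(B) = GL_n(B) ∩ H(A)` of `H(A)`. -/
def GLEmbedding.integralPoints (B : Subring A) : Subgroup (Points K R A) :=
  (Matrix.GeneralLinearGroup.map B.subtype).range.comap (ι.toGL A)

lemma GLEmbedding.mem_integralPoints_of (B : Subring A) (x : Points K R A)
    (h : ∀ i j, x.hom (ι.u i j) ∈ B) (h' : ∀ i j, x⁻¹.hom (ι.u i j) ∈ B) :
    x ∈ ι.integralPoints B := by
  have hinj : Function.Injective (fun M : Matrix (Fin n) (Fin n) B => B.subtype.mapMatrix M) := by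
    intro M N hMN
    ext i j
    exact congrFun (congrFun hMN i) j
  have e1 : B.subtype.mapMatrix (Matrix.of fun i j => (⟨_, h i j⟩ : B)) = ι.toMatrix A x := rfl
  have e2 : B.subtype.mapMatrix (Matrix.of fun i j => (⟨_, h' i j⟩ : B)) = ι.toMatrix A x⁻¹ := rfl
  refine ⟨⟨Matrix.of fun i j => ⟨_, h i j⟩, Matrix.of fun i j => ⟨_, h' i j⟩, ?_, ?_⟩, ?_⟩
  · apply hinj
    simp only [map_mul, map_one, e1, e2]
    rw [← map_mul, mul_inv_cancel, map_one]
  · apply hinj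
    simp only [map_mul, map_one, e1, e2]
    rw [← map_mul, inv_mul_cancel, map_one]
  · ext i j
    rfl

end Embedding

section Adelic

/-- The set of places of a number field `K`: the archimedean places and the finite places. -/
abbrev Place (K : Type*) [Field K] : Type _ := InfinitePlace K ⊕ HeightOneSpectrum (𝓞 K)

variable {K R : Type*} [Field K] [NumberField K] [CommRing R] [HopfAlgebra K R]

/-- The archimedean places in `S`. -/
abbrev infPart (S : Set (Place K)) : Set (InfinitePlace K) := Sum.inl ⁻¹' S

/-- The finite places in `S`. -/
abbrev finPart (S : Set (Place K)) : Set (HeightOneSpectrum (𝓞 K)) := Sum.inr ⁻¹' S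

/-- The ring `𝓞[S]` of `S`-integers: the `x ∈ K` with `|x|_ν ≤ 1` for all finite places `ν ∉ S`. -/
abbrev sIntegers (S : Set (Place K)) : Subring K := ((finPart S).integer K).toSubring

variable {n : ℕ} (ι : GLEmbedding K R n)

/-- The subgroup `H(𝓞_ν)` of `H(K_ν)` for a finite place `ν`. -/
abbrev localIntegralPoints (v : HeightOneSpectrum (𝓞 K)) :
    Subgroup (Points K R (v.adicCompletion K)) :=
  ι.integralPoints (v.adicCompletionIntegers K).toSubring

/-- The group `H(𝓞[S])`, as a subgroup of `H(K)`. -/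
abbrev sIntegralPoints (S : Set (Place K)) : Subgroup (Points K R K) :=
  ι.integralPoints (sIntegers S)

/-- The `S`-adelic group `H_S`: the families `(x_ν)`, `ν ∈ S`, with `x_ν ∈ H(K_ν)`, such that
`x_ν ∈ H(𝓞_ν)` for almost all finite `ν ∈ S`. (There are only finitely many archimedean places.) -/
abbrev SAdelicPoints (S : Set (Place K)) : Type _ :=
  (∀ v : infPart S, Points K R v.1.Completion) ×
    Πʳ v : finPart S, [Points K R (v.1.adicCompletion K), localIntegralPoints ι v.1]

lemma finite_not_mem_localIntegralPoints (x : Points K R K) :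
    {v : HeightOneSpectrum (𝓞 K) |
      Points.ofBase K R (v.adicCompletion K) x ∉ localIntegralPoints ι v}.Finite := by
  have key : ∀ y : Points K R K, (⋃ p : Fin n × Fin n,
      HeightOneSpectrum.Support (𝓞 K) (y.hom (ι.u p.1 p.2))).Finite := fun y =>
    Set.finite_iUnion fun p => HeightOneSpectrum.Support.finite (𝓞 K) _
  refine ((key x).union (key x⁻¹)).subset ?_
  intro v hv
  by_contra hcon
  apply hv
  simp only [Set.mem_union, Set.mem_iUnion, not_or, not_exists] at hcon
  have aux : ∀ y : Points K R K, (∀ p : Fin n × Fin n,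
      v ∉ HeightOneSpectrum.Support (𝓞 K) (y.hom (ι.u p.1 p.2))) → ∀ i j,
      (Points.ofBase K R (v.adicCompletion K) y).hom (ι.u i j) ∈
        (v.adicCompletionIntegers K).toSubring := by
    intro y hy i j
    have h1 : v.valuation K (y.hom (ι.u i j)) ≤ 1 := not_lt.mp (hy (i, j))
    rw [← HeightOneSpectrum.valuedAdicCompletion_eq_valuation'] at h1
    exact h1
  refine ι.mem_integralPoints_of _ _ (aux x hcon.1) ?_
  rw [← map_inv]
  exact aux x⁻¹ hcon.2

/-- The diagonal homomorphism `H(K) → H_S`. -/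
def diag (S : Set (Place K)) : Points K R K →* SAdelicPoints ι S where
  toFun x :=
    (fun v => Points.ofBase K R v.1.Completion x,
      ⟨fun v => Points.ofBase K R (v.1.adicCompletion K) x,
        (finite_not_mem_localIntegralPoints ι x).preimage Subtype.val_injective.injOn⟩)
  map_one' := by
    refine Prod.ext ?_ (DFunLike.ext _ _ fun v => ?_)
    · funext v
      exact (Points.ofBase K R v.1.Completion).map_one
    · exact (Points.ofBase K R (v.1.adicCompletion K)).map_one
  map_mul' x y := by
    refine Prod.ext ?_ (DFunLike.ext _ _ fun v => ?_)
    · funext v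
      exact (Points.ofBase K R v.1.Completion).map_mul x y
    · exact (Points.ofBase K R (v.1.adicCompletion K)).map_mul x y

/-- If `S` is nonempty, the diagonal homomorphism is an embedding. -/
lemma diag_injective (S : Set (Place K)) (hS : S.Nonempty) :
    Function.Injective (diag (R := R) ι S) := by
  have base : ∀ (L : Type _) [Field L] [Algebra K L],
      Function.Injective (Points.ofBase K R L) := by
    intro L _ _ x y h
    ext c
    exact (algebraMap K L).injective (DFunLike.congr_fun (congrArg Points.hom h) c)
  intro x y h
  obtain ⟨v | v, hv⟩ := hS
  · exact base _ (congrFun (congrArg Prod.fst h) ⟨v, hv⟩)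
  · exact base _ (DFunLike.congr_fun (congrArg Prod.snd h) ⟨v, hv⟩)

end Adelic

end AlgGrp

end

open NumberField IsDedekindDomain
open scoped TensorProduct RestrictedProduct Topology Pointwise

/-! Write Γ for the group of S-integral points. If g in H_S commensurates Γ, the group Δ of all x in
H(K) with g x g⁻¹ in Γ meets Γ in finite index. Each component of g then solves the equations h x =
φ(x) h for x in Δ, which are defined over K. Two solutions in H(K̄) differ by an element
centralizing Δ; since H is connected and Γ is dense, it is central
(`mem_center_of_commute_finiteIndex`), hence trivial as H is adjoint. If S is nonempty, the solution
scheme has a point over some K_ν, so it has exactly one geometric point. Galois descent makes this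
point rational, and every field-valued solution comes from it (`exists_rational_transporter`); thus
all components of g are the same element of H(K).

Conversely, let g be in H(K) and let m be a common denominator of g and g⁻¹. Conjugation by g⁻¹ maps
the congruence subgroup of Γ modulo m² into Γ, and this subgroup has finite index because 𝓞[S]/m² is
finite (`finite_quotient_span_natCast`). -/

/-- A subgroup with closed left cosets which meets a dense subgroup of a connected group in a
subgroup of finite index is the whole group. -/
lemma Subgroup.eq_top_of_relIndex_dense {G : Type*} [Group G] [TopologicalSpace G]
    [ConnectedSpace G] (Z D : Subgroup G) (hZ : ∀ g : G, IsClosed {x | g * x ∈ Z})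
    (hD : Dense (D : Set G)) (hi : Z.relIndex D ≠ 0) : Z = ⊤ := by
  have : (Z.subgroupOf D).FiniteIndex := ⟨hi⟩
  -- Finitely many closed cosets of `Z` cover `D`, hence also its closure.
  have hcov : (⋃ q : D ⧸ Z.subgroupOf D, {x : G | (q.out : G)⁻¹ * x ∈ Z}) = Set.univ := by
    rw [← Set.univ_subset_iff, ← hD.closure_eq]
    refine (isClosed_iUnion_of_finite fun q => hZ _).closure_subset_iff.2 fun x hx => ?_
    refine Set.mem_iUnion.2 ⟨(QuotientGroup.mk (⟨x, hx⟩ : D)), ?_⟩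
    exact Subgroup.mem_subgroupOf.1 (QuotientGroup.eq.1
      (QuotientGroup.out_eq' (QuotientGroup.mk (⟨x, hx⟩ : D) : D ⧸ Z.subgroupOf D)))
  have hclosed : IsClosed (Z : Set G) := by simpa using hZ 1
  have hcompl : (Z : Set G)ᶜ = ⋃ q : {q : D ⧸ Z.subgroupOf D // (q.out : G) ∉ Z},
      {x : G | (q.1.out : G)⁻¹ * x ∈ Z} := by
    ext x
    simp only [Set.mem_compl_iff, SetLike.mem_coe, Set.mem_iUnion, Set.mem_ofPred_eq]
    constructor
    · intro hx
      obtain ⟨q, hq⟩ := Set.mem_iUnion.1 (hcov.symm ▸ Set.mem_univ x)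
      refine ⟨⟨q, fun h => hx ?_⟩, hq⟩
      simpa using Z.mul_mem h hq
    · rintro ⟨⟨q, hq⟩, hx⟩ h
      refine hq ?_
      have := Z.mul_mem h (Z.inv_mem hx)
      simpa using this
  have hopen : IsOpen (Z : Set G) := by
    rw [← isClosed_compl_iff, hcompl]
    exact isClosed_iUnion_of_finite fun q => hZ _
  exact SetLike.coe_injective (IsClopen.eq_univ ⟨hclosed, hopen⟩ ⟨1, Z.one_mem⟩)

namespace AlgGrp

section Field

variable {K : Type*} [Field K]

lemma Points.map_ofBase {R : Type*} [CommRing R] [HopfAlgebra K R]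
    {A B : Type*} [CommRing A] [Algebra K A] [CommRing B] [Algebra K B]
    (f : A →ₐ[K] B) (x : Points K R K) :
    Points.map K R f (Points.ofBase K R A x) = Points.ofBase K R B x := by
  ext c
  exact f.commutes _

/-! ### Zariski density and centralizers -/

section Zariski

variable {R : Type*} [CommRing R] [HopfAlgebra K R]

/-- Over K̄ ⊗ K[H] the tautological point `u` turns the equation into functions `F r`; evaluating
them at x gives the differences of coordinates of the two sides. -/
lemma isClosed_zariski_setOf_mul_mul_eq (a b c d : Points K R (AlgebraicClosure K)) :
    IsClosed[zariski K R] {x | a * x * b = c * x * d} := by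
  let L := AlgebraicClosure K
  let j : L →ₐ[K] L ⊗[K] R := Algebra.TensorProduct.includeLeft
  let u : Points K R (L ⊗[K] R) := ⟨Algebra.TensorProduct.includeRight⟩
  let J := Points.map K R j
  let F : R → L ⊗[K] R := fun r => (J a * u * J b).hom r - (J c * u * J d).hom r
  have hev : ∀ x : Points K R L, ∃ e : L ⊗[K] R →ₐ[K] L,
      (∀ t, t ∈ (toSpec K R L x).asIdeal ↔ e t = 0) ∧ Points.map K R e u = x ∧
      ∀ y, Points.map K R e (J y) = y := by
    intro x
    let e := Algebra.TensorProduct.lift (Algebra.ofId L L) x.hom (fun _ _ => Commute.all _ _)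
    refine ⟨e.restrictScalars K, fun t => Iff.rfl, ?_, fun y => ?_⟩
    · ext r
      change e (1 ⊗ₜ r) = x.hom r
      simp [e]
    · ext r
      change e (y.hom r ⊗ₜ 1) = y.hom r
      simp [e]
  let := zariski K R
  have hset : {x | a * x * b = c * x * d} =
      toSpec K R L ⁻¹' PrimeSpectrum.zeroLocus (Set.range F) := by
    ext x
    obtain ⟨e, he, hu, hJ⟩ := hev x
    have hF : ∀ r, e (F r) = (a * x * b).hom r - (c * x * d).hom r := by
      intro r
      have h1 : Points.map K R e (J a * u * J b) = a * x * b := by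
        rw [map_mul, map_mul, hu, hJ, hJ]
      have h2 : Points.map K R e (J c * u * J d) = c * x * d := by
        rw [map_mul, map_mul, hu, hJ, hJ]
      rw [map_sub, ← h1, ← h2]
      rfl
    simp only [Set.mem_ofPred_eq, Set.mem_preimage, PrimeSpectrum.mem_zeroLocus,
      Set.range_subset_iff, SetLike.mem_coe, he, hF, sub_eq_zero]
    rw [Points.ext_iff, AlgHom.ext_iff]
  rw [hset]
  exact (PrimeSpectrum.isClosed_zeroLocus _).preimage continuous_induced_dom

/-- In a connected group, an element commuting with a subgroup of finite index in a Zariski dense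
group is central. -/
lemma mem_center_of_commute_finiteIndex (hconn : IsConnectedGroup K R)
    {Γ Δ : Subgroup (Points K R K)} (hdense : IsZariskiDense K R (Γ : Set (Points K R K)))
    (hΔ : Δ.relIndex Γ ≠ 0) {z : Points K R (AlgebraicClosure K)}
    (hz : ∀ x ∈ Δ, Commute z (Points.ofBase K R (AlgebraicClosure K) x)) :
    z ∈ Subgroup.center (Points K R (AlgebraicClosure K)) := by
  let Z := Subgroup.centralizer ({z} : Set (Points K R (AlgebraicClosure K)))
  let := zariski K R
  have : ConnectedSpace (Points K R (AlgebraicClosure K)) := hconn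
  have hZ : Z = ⊤ := by
    refine Subgroup.eq_top_of_relIndex_dense Z (Γ.map (Points.ofBase K R (AlgebraicClosure K)))
      (fun g => ?_) (by rwa [Subgroup.coe_map]) ?_
    · convert isClosed_zariski_setOf_mul_mul_eq (z * g) 1 g z using 2
      ext x
      simp only [Z, Subgroup.mem_centralizer_singleton_iff, mul_one, mul_assoc]
      exact eq_comm
    · rw [← Subgroup.relIndex_comap]
      have hle : Δ ≤ Z.comap (Points.ofBase K R (AlgebraicClosure K)) := fun x hx =>
        Subgroup.mem_centralizer_singleton_iff.2 (hz x hx).symm.eq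
      exact fun h => hΔ (Nat.eq_zero_of_zero_dvd (h ▸ Subgroup.relIndex_dvd_of_le_left Γ hle))
  refine Subgroup.mem_center_iff.2 fun g => ?_
  have : g ∈ Z := hZ ▸ Subgroup.mem_top g
  exact Subgroup.mem_centralizer_singleton_iff.1 this

end Zariski

/-! ### Galois descent of a unique geometric point -/

/-- A nonempty affine scheme of finite type over a perfect field with at most one geometric point
has a rational point, and every field-valued point of it comes from this rational point. -/
lemma exists_algHom_of_subsingleton [PerfectField K] (B : Type*) [CommRing B] [Algebra K B]
    [Algebra.FiniteType K B] [Nontrivial B]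
    (h : ∀ f g : B →ₐ[K] AlgebraicClosure K, f = g) :
    ∃ e : B →ₐ[K] K, ∀ (L : Type*) [Field L] [Algebra K L] (f : B →ₐ[K] L),
      f = (Algebra.ofId K L).comp e := by
  -- Nullstellensatz: residue fields at maximal ideals are finite over K, so they embed in K̄.
  have hmax : ∀ m : Ideal B, m.IsMaximal →
      ∃ f : B →ₐ[K] AlgebraicClosure K, ∀ b, f b = 0 → b ∈ m := by
    intro m hm
    let := Ideal.Quotient.field m
    have : Module.Finite K (B ⧸ m) := finite_of_finite_type_of_isJacobsonRing K (B ⧸ m)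
    let i : B ⧸ m →ₐ[K] AlgebraicClosure K := IsAlgClosed.lift
    refine ⟨i.comp (Ideal.Quotient.mkₐ K m), fun b hb => ?_⟩
    refine Ideal.Quotient.eq_zero_iff_mem.1 (i.toRingHom.injective ?_)
    rw [map_zero]
    exact hb
  obtain ⟨m₀, hm₀⟩ := Ideal.exists_maximal B
  obtain ⟨f₀, -⟩ := hmax m₀ hm₀
  -- Uniqueness makes `f₀` Galois invariant, so its values lie in K, which is perfect.
  have hbot : ∀ b, f₀ b ∈ (⊥ : IntermediateField K (AlgebraicClosure K)) := fun b =>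
    (InfiniteGalois.mem_bot_iff_fixed _).2 fun σ =>
      DFunLike.congr_fun (h (σ.toAlgHom.comp f₀) f₀) b
  let e : B →ₐ[K] K := (IntermediateField.botEquiv K (AlgebraicClosure K)).toAlgHom.comp
    (f₀.codRestrict (⊥ : IntermediateField K (AlgebraicClosure K)).toSubalgebra hbot)
  have he : ∀ b, algebraMap K (AlgebraicClosure K) (e b) = f₀ b := by
    intro b
    obtain ⟨k, hk⟩ := IntermediateField.mem_bot.1 (hbot b)
    have : (⟨f₀ b, hbot b⟩ : (⊥ : IntermediateField K (AlgebraicClosure K))) =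
        algebraMap K _ k := Subtype.ext hk.symm
    change algebraMap K (AlgebraicClosure K)
      (IntermediateField.botEquiv K (AlgebraicClosure K) ⟨f₀ b, hbot b⟩) = _
    rw [this, IntermediateField.botEquiv_def, hk]
  have : IsJacobsonRing B := isJacobsonRing_of_finiteType (A := K)
  refine ⟨e, fun L _ _ f => AlgHom.ext fun b => ?_⟩
  -- The scheme may be non-reduced: `b - e b` vanishes at every closed point, so it is only
  -- nilpotent, which suffices for maps to fields.
  have hnil : b - algebraMap K B (e b) ∈ (⊥ : Ideal B).radical := by
    rw [Ideal.radical_eq_jacobson, Ideal.jacobson, Ideal.mem_sInf]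
    rintro m ⟨-, hm⟩
    obtain ⟨f, hf⟩ := hmax m hm
    refine hf _ ?_
    rw [h f f₀, map_sub, AlgHom.commutes, he, sub_self]
  obtain ⟨k, hk⟩ := hnil
  have h0 : f (b - algebraMap K B (e b)) = 0 :=
    eq_zero_of_pow_eq_zero (n := k) (by rw [← map_pow, (Submodule.mem_bot B).1 hk, map_zero])
  rw [map_sub, AlgHom.commutes, sub_eq_zero] at h0
  exact h0

/-! ### The scheme of elements conjugating one family to another -/

section Transporter

variable {R : Type*} [CommRing R] [HopfAlgebra K R] {I : Type*} (γ φ : I → Points K R K)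

/-- The ideal of the closed subscheme of `H` given by the equations `h * γ i = φ i * h`. -/
def transporterIdeal : Ideal R :=
  Ideal.span (Set.range fun p : I × R =>
    ((⟨AlgHom.id K R⟩ : Points K R R) * Points.ofBase K R R (γ p.1)).hom p.2 -
      (Points.ofBase K R R (φ p.1) * ⟨AlgHom.id K R⟩).hom p.2)

variable {γ φ} {A : Type*} [CommRing A] [Algebra K A]

/-- Every point x is the image under `x.hom` of the universal point, the identity of K[H], and the
ideal is generated by the equations for that point. -/
lemma transporterIdeal_le_ker_iff (x : Points K R A) :
    transporterIdeal γ φ ≤ RingHom.ker x.hom ↔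
      ∀ i, x * Points.ofBase K R A (γ i) = Points.ofBase K R A (φ i) * x := by
  have hu : Points.map K R x.hom (⟨AlgHom.id K R⟩ : Points K R R) = x := rfl
  have h1 : ∀ i, x * Points.ofBase K R A (γ i) =
      Points.map K R x.hom (⟨AlgHom.id K R⟩ * Points.ofBase K R R (γ i)) := fun i => by
    rw [map_mul, Points.map_ofBase, hu]
  have h2 : ∀ i, Points.ofBase K R A (φ i) * x =
      Points.map K R x.hom (Points.ofBase K R R (φ i) * ⟨AlgHom.id K R⟩) := fun i => by
    rw [map_mul, Points.map_ofBase, hu]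
  simp only [transporterIdeal, Ideal.span_le, Set.range_subset_iff, Prod.forall, SetLike.mem_coe,
    RingHom.mem_ker, map_sub, sub_eq_zero, h1, h2, Points.ext_iff, AlgHom.ext_iff]
  rfl

/-- If at most one geometric point `h` satisfies the equations `h * γ i = φ i * h`, and some field
extension contains a solution, then all solutions over extension fields come from one rational
point. -/
lemma exists_rational_transporter [PerfectField K] [Algebra.FiniteType K R]
    (huniq : ∀ h h' : Points K R (AlgebraicClosure K),
      (∀ i, h * Points.ofBase K R _ (γ i) = Points.ofBase K R _ (φ i) * h) →
      (∀ i, h' * Points.ofBase K R _ (γ i) = Points.ofBase K R _ (φ i) * h') → h = h')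
    [Nontrivial A] (x₀ : Points K R A)
    (hx₀ : ∀ i, x₀ * Points.ofBase K R A (γ i) = Points.ofBase K R A (φ i) * x₀) :
    ∃ h : Points K R K, ∀ (L : Type*) [Field L] [Algebra K L] (x : Points K R L),
      (∀ i, x * Points.ofBase K R L (γ i) = Points.ofBase K R L (φ i) * x) →
      x = Points.ofBase K R L h := by
  set J := transporterIdeal γ φ
  have hJtop : J ≠ ⊤ := fun h =>
    RingHom.ker_ne_top x₀.hom.toRingHom
      (top_le_iff.1 (h ▸ (transporterIdeal_le_ker_iff x₀).2 hx₀))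
  have : Nontrivial (R ⧸ J) := Ideal.Quotient.nontrivial_iff.2 hJtop
  obtain ⟨e, he⟩ := exists_algHom_of_subsingleton (K := K) (R ⧸ J) fun f g => by
    have hker : ∀ f : R ⧸ J →ₐ[K] AlgebraicClosure K,
        J ≤ RingHom.ker (f.comp (Ideal.Quotient.mkₐ K J)) := fun f r hr => by
      rw [RingHom.mem_ker, AlgHom.comp_apply, Ideal.Quotient.mkₐ_eq_mk,
        Ideal.Quotient.eq_zero_iff_mem.2 hr, map_zero]
    exact Ideal.Quotient.algHom_ext K (congrArg Points.hom
      (huniq ⟨_⟩ ⟨_⟩ ((transporterIdeal_le_ker_iff _).1 (hker f))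
        ((transporterIdeal_le_ker_iff _).1 (hker g))))
  refine ⟨⟨e.comp (Ideal.Quotient.mkₐ K J)⟩, fun L _ _ x hx => ?_⟩
  have hk := (transporterIdeal_le_ker_iff x).2 hx
  have := he L (Ideal.Quotient.liftₐ J x.hom hk)
  ext r
  exact DFunLike.congr_fun this (Ideal.Quotient.mk J r)

end Transporter

end Field

/-! ### Finite quotients and congruence subgroups -/

section Integral

/-- A subring of a number field has finite quotients by nonzero integers. -/
lemma finite_quotient_span_natCast {K : Type*} [Field K] [NumberField K] (B : Subring K) (m : ℕ)
    (hm : m ≠ 0) : Finite (B ⧸ Ideal.span {(m : B)}) := by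
  by_contra hinf
  rw [not_finite_iff_infinite] at hinf
  -- One more than the largest possible order of N/mN, for N a finitely generated additive subgroup
  -- of K.
  set k := m ^ Module.finrank ℚ K + 1
  let y : Fin k ↪ B ⧸ Ideal.span {(m : B)} := Fin.valEmbedding.trans (Infinite.natEmbedding _)
  choose x hx using fun i => Ideal.Quotient.mk_surjective (y i)
  let N : Submodule ℤ B := Submodule.span ℤ (Set.range x)
  have : Module.Finite ℤ N := Module.Finite.span_of_finite ℤ (Set.finite_range x)
  have hrank : Module.finrank ℤ N ≤ Module.finrank ℚ K := by
    let b := Module.finBasis ℤ N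
    have hb : LinearIndependent ℤ fun i => ((b i : B) : K) :=
      (b.linearIndependent.map' N.subtype N.ker_subtype).map'
        (B.subtype : B →+ K).toIntLinearMap
        (LinearMap.ker_eq_bot.2 Subtype.val_injective)
    simpa using ((LinearIndependent.iff_fractionRing ℤ ℚ).1 hb).fintype_card_le_finrank
  let P := (nsmulAddMonoidHom (α := N) m).range
  have hidx : P.index = m ^ Module.finrank ℤ N := AddSubgroup.index_range_nsmul N m
  have : P.FiniteIndex := ⟨by rw [hidx]; exact pow_ne_zero _ hm⟩
  -- Elements congruent modulo mN are congruent modulo mB, where the `x i` are distinct.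
  have hinj : Function.Injective fun i : Fin k =>
      (QuotientAddGroup.mk (⟨x i, Submodule.subset_span ⟨i, rfl⟩⟩ : N) : N ⧸ P) := by
    intro i j hij
    obtain ⟨t, ht⟩ := QuotientAddGroup.eq.1 hij
    refine y.injective ?_
    rw [← hx, ← hx, eq_comm, Ideal.Quotient.eq, Ideal.mem_span_singleton]
    refine ⟨t, ?_⟩
    have := congrArg (Subtype.val : N → B) ht
    simp only [nsmulAddMonoidHom_apply, Submodule.coe_add, Submodule.coe_neg,
      Submodule.coe_smul_of_tower, nsmul_eq_mul] at this
    rw [this]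
    ring
  have hcard := Nat.card_le_card_of_injective _ hinj
  rw [← AddSubgroup.index, hidx, Nat.card_eq_fintype_card, Fintype.card_fin] at hcard
  have := Nat.pow_le_pow_right (Nat.pos_of_ne_zero hm) hrank
  omega

variable {K R : Type*} [Field K] [CommRing R] [HopfAlgebra K R] {n : ℕ} (ι : GLEmbedding K R n)

lemma GLEmbedding.hom_u_mem {A : Type*} [CommRing A] [Algebra K A] {B : Subring A}
    {x : Points K R A} (hx : x ∈ ι.integralPoints B) (i j : Fin n) : x.hom (ι.u i j) ∈ B := by
  obtain ⟨M, hM⟩ := hx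
  have : x.hom (ι.u i j) = (ι.toGL A x : Matrix (Fin n) (Fin n) A) i j := rfl
  rw [this, ← hM]
  exact (M.1 i j).2

/-- Integral points as matrices over the ring. -/
def GLEmbedding.integralMatrix {A : Type*} [CommRing A] [Algebra K A] (B : Subring A) :
    ι.integralPoints B →* Matrix (Fin n) (Fin n) B where
  toFun x := Matrix.of fun i j => ⟨_, ι.hom_u_mem x.2 i j⟩
  map_one' := by
    ext i j
    refine (congrFun (congrFun (map_one (ι.toMatrix A)) i) j).trans ?_
    rw [Matrix.one_apply, Matrix.one_apply]
    split_ifs <;> rfl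
  map_mul' x y := by
    ext i j
    refine (congrFun (congrFun (map_mul (ι.toMatrix A) x.1 y.1) i) j).trans ?_
    simp [Matrix.mul_apply]
    rfl

variable [NumberField K]

lemma exists_natCast_mul_mem {I : Type*} [Finite I] (B : Subring K)
    (hB : ∀ x : 𝓞 K, (x : K) ∈ B) (f : I → K) :
    ∃ m : ℕ, m ≠ 0 ∧ ∀ i, (m : K) * f i ∈ B := by
  have : Algebra.IsAlgebraic ℤ K :=
    (IsFractionRing.comap_isAlgebraic_iff (A := ℤ) (K := ℚ) (C := K)).2 inferInstance
  obtain ⟨y, hy, h⟩ :=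
    Algebra.IsAlgebraic.exists_integral_multiples ℤ (Set.finite_range f).toFinset
  refine ⟨y.natAbs, Int.natAbs_ne_zero.2 hy, fun i => ?_⟩
  have hi : (y : K) * f i ∈ B := by
    rw [← zsmul_eq_mul]
    exact hB ⟨_, h (f i) (by simp)⟩
  rw [Nat.cast_natAbs]
  rcases abs_choice y with hc | hc <;> rw [hc]
  · exact hi
  · rw [Int.cast_neg, neg_mul]
    exact B.neg_mem hi

lemma relIndex_conj_integralPoints_ne_zero (B : Subring K) (hB : ∀ x : 𝓞 K, (x : K) ∈ B)
    (g : Points K R K) :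
    (ConjAct.toConjAct g • ι.integralPoints B).relIndex (ι.integralPoints B) ≠ 0 := by
  obtain ⟨m, hm, hmem⟩ := exists_natCast_mul_mem B hB
    (fun p : Bool × Fin n × Fin n => (bif p.1 then g else g⁻¹).hom (ι.u p.2.1 p.2.2))
  have hg : ∀ i j, (m : K) * g.hom (ι.u i j) ∈ B := fun i j => hmem (true, i, j)
  have hg' : ∀ i j, (m : K) * g⁻¹.hom (ι.u i j) ∈ B := fun i j => hmem (false, i, j)
  -- The square supplies one factor m to clear g⁻¹ on the left and one to clear g on the right.
  have := finite_quotient_span_natCast B (m ^ 2) (pow_ne_zero 2 hm)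
  let I := Ideal.span {((m ^ 2 : ℕ) : B)}
  let ρ : ι.integralPoints B →* (Matrix (Fin n) (Fin n) (B ⧸ I))ˣ :=
    (((Ideal.Quotient.mk I).mapMatrix : _ →+* Matrix (Fin n) (Fin n) (B ⧸ I)).toMonoidHom.comp
      (ι.integralMatrix B)).toHomUnits
  have hentry : ∀ x : ι.integralPoints B, x ∈ ρ.ker → ∀ i j,
      (g⁻¹ * x.1 * g).hom (ι.u i j) ∈ B := by
    intro x hx i j
    have h1 : ∀ i j, ∃ t : B, x.1.hom (ι.u i j) =
        (1 : Matrix (Fin n) (Fin n) K) i j + (m : K) ^ 2 * t := by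
      intro i j
      have h2 : Ideal.Quotient.mk I (ι.integralMatrix B x i j) =
          Ideal.Quotient.mk I ((1 : Matrix (Fin n) (Fin n) B) i j) := by
        have h3 : (ρ x : Matrix (Fin n) (Fin n) (B ⧸ I)) = 1 := by
          rw [MonoidHom.mem_ker.1 hx, Units.val_one]
        refine (congrFun (congrFun h3 i) j).trans ?_
        simp only [Matrix.one_apply]
        split_ifs <;> simp
      rw [Ideal.Quotient.eq, Ideal.mem_span_singleton] at h2
      obtain ⟨t, ht⟩ := h2
      refine ⟨t, ?_⟩
      have h3 := congrArg (Subtype.val : B → K) ht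
      have h4 : (((1 : Matrix (Fin n) (Fin n) B) i j : B) : K) =
          (1 : Matrix (Fin n) (Fin n) K) i j := by
        simp only [Matrix.one_apply]
        split_ifs <;> rfl
      rw [← h4, ← sub_eq_iff_eq_add']
      have h5 : ((ι.integralMatrix B x i j : B) : K) = x.1.hom (ι.u i j) := rfl
      simpa [h5] using h3
    choose t ht using h1
    have hx' : ι.toMatrix K x.1 = 1 + (m : K) ^ 2 • Matrix.of fun i j => (t i j : K) := by
      ext i j
      exact ht i j
    have hmat : ι.toMatrix K (g⁻¹ * x.1 * g) = 1 + ((m : K) • ι.toMatrix K g⁻¹) *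
        (Matrix.of fun i j => (t i j : K)) * ((m : K) • ι.toMatrix K g) := by
      rw [map_mul, map_mul, hx', mul_add, mul_one, add_mul, ← map_mul, inv_mul_cancel, map_one]
      simp only [smul_mul_assoc, mul_smul_comm, smul_smul, sq]
    have : (g⁻¹ * x.1 * g).hom (ι.u i j) = ι.toMatrix K (g⁻¹ * x.1 * g) i j := rfl
    rw [this, hmat, Matrix.add_apply]
    refine B.add_mem ?_ ?_
    · rw [Matrix.one_apply]
      split_ifs
      exacts [B.one_mem, B.zero_mem]
    · rw [Matrix.mul_apply]
      refine B.sum_mem fun k _ => B.mul_mem ?_ (hg k j)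
      rw [Matrix.mul_apply]
      exact B.sum_mem fun l _ => B.mul_mem (hg' i l) (t l k).2
  have hle : ρ.ker ≤ (ConjAct.toConjAct g • ι.integralPoints B).subgroupOf
      (ι.integralPoints B) := by
    intro x hx
    rw [Subgroup.mem_subgroupOf, Subgroup.mem_pointwise_smul_iff_inv_smul_mem, ← map_inv,
      ConjAct.toConjAct_smul, inv_inv]
    refine ι.mem_integralPoints_of _ _ (hentry x hx) fun i j => ?_
    have : (g⁻¹ * x.1 * g)⁻¹ = g⁻¹ * (x⁻¹).1 * g := by
      rw [Subgroup.coe_inv]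
      group
    rw [this]
    exact hentry x⁻¹ (inv_mem hx) i j
  exact (Subgroup.finiteIndex_of_le hle).index_ne_zero

end Integral

/-! ### The two inclusions -/

section Commensurator

variable {K R : Type*} [Field K] [NumberField K] [CommRing R] [HopfAlgebra K R] {n : ℕ}
  (ι : GLEmbedding K R n) (S : Set (Place K))

lemma mem_commensurator_sIntegralPoints (g : Points K R K) :
    g ∈ Subgroup.Commensurable.commensurator (sIntegralPoints ι S) := by
  have hB : ∀ x : 𝓞 K, (x : K) ∈ sIntegers S := fun x =>
    ((finPart S).integer K).algebraMap_mem x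
  have key := relIndex_conj_integralPoints_ne_zero ι (sIntegers S) hB
  refine (Subgroup.Commensurable.commensurator_mem_iff _ _).2 ⟨key g, ?_⟩
  rw [← Subgroup.relIndex_pointwise_smul (ConjAct.toConjAct g)⁻¹, inv_smul_smul, ← map_inv]
  exact key g⁻¹

lemma diag_mem_commensurator (g : Points K R K) :
    diag ι S g ∈ Subgroup.Commensurable.commensurator ((sIntegralPoints ι S).map (diag ι S)) := by
  obtain ⟨h1, h2⟩ := (Subgroup.Commensurable.commensurator_mem_iff _ _).1
    (mem_commensurator_sIntegralPoints ι S g)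
  have hmap : ConjAct.toConjAct (diag ι S g) • (sIntegralPoints ι S).map (diag ι S) =
      (ConjAct.toConjAct g • sIntegralPoints ι S).map (diag ι S) := by
    ext x
    simp only [Subgroup.mem_smul_pointwise_iff_exists, Subgroup.mem_map, ConjAct.toConjAct_smul]
    constructor
    · rintro ⟨_, ⟨y, hy, rfl⟩, rfl⟩
      exact ⟨g * y * g⁻¹, ⟨y, hy, rfl⟩, by simp only [map_mul, map_inv]⟩
    · rintro ⟨_, ⟨y, hy, rfl⟩, rfl⟩
      exact ⟨_, ⟨y, hy, rfl⟩, by simp only [map_mul, map_inv]⟩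
  -- No injectivity of `diag` is needed, so empty S is covered.
  have hrel : ∀ A B : Subgroup (Points K R K), A.relIndex B ≠ 0 →
      (A.map (diag ι S)).relIndex (B.map (diag ι S)) ≠ 0 := fun A B h => by
    rw [← Subgroup.relIndex_comap]
    exact fun h0 => h (Nat.eq_zero_of_zero_dvd
      (h0 ▸ Subgroup.relIndex_dvd_of_le_left B (Subgroup.le_comap_map _ A)))
  rw [Subgroup.Commensurable.commensurator_mem_iff, hmap]
  exact ⟨hrel _ _ h1, hrel _ _ h2⟩

variable [Algebra.FiniteType K R]

lemma mem_range_diag_of_mem_commensurator (hconn : IsConnectedGroup K R) (hadj : IsAdjoint K R)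
    (hdense : IsZariskiDense K R (sIntegralPoints ι S : Set (Points K R K)))
    {g : SAdelicPoints ι S}
    (hg : g ∈ Subgroup.Commensurable.commensurator ((sIntegralPoints ι S).map (diag ι S))) :
    g ∈ (diag ι S).range := by
  let Δ := (ConjAct.toConjAct g⁻¹ • (sIntegralPoints ι S).map (diag ι S)).comap (diag ι S)
  have hΔ : Δ.relIndex (sIntegralPoints ι S) ≠ 0 := by
    rw [Subgroup.relIndex_comap]
    exact ((Subgroup.Commensurable.commensurator_mem_iff _ _).1 (inv_mem hg)).1
  have hφ : ∀ x : Δ, ∃ y : Points K R K, g * diag ι S x = diag ι S y * g := by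
    rintro ⟨x, hx⟩
    rw [Subgroup.mem_comap, Subgroup.mem_smul_pointwise_iff_exists] at hx
    obtain ⟨_, ⟨y, -, rfl⟩, hy⟩ := hx
    refine ⟨y, ?_⟩
    rw [← hy, ConjAct.toConjAct_smul]
    group
  -- Any choice of `φ` will do: only the equations matter, not that it be a homomorphism.
  choose φ hφ using hφ
  have hinf : ∀ (v : infPart S) (x : Δ), g.1 v * Points.ofBase K R v.1.Completion x =
      Points.ofBase K R v.1.Completion (φ x) * g.1 v := fun v x =>
    congrFun (congrArg Prod.fst (hφ x)) v
  have hfin : ∀ (v : finPart S) (x : Δ), g.2 v * Points.ofBase K R (v.1.adicCompletion K) x =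
      Points.ofBase K R (v.1.adicCompletion K) (φ x) * g.2 v := fun v x =>
    DFunLike.congr_fun (congrArg Prod.snd (hφ x)) v
  have huniq : ∀ h h' : Points K R (AlgebraicClosure K),
      (∀ x : Δ, h * Points.ofBase K R _ x = Points.ofBase K R _ (φ x) * h) →
      (∀ x : Δ, h' * Points.ofBase K R _ x = Points.ofBase K R _ (φ x) * h') → h = h' := by
    intro h h' hh hh'
    have hc : h⁻¹ * h' ∈ Subgroup.center (Points K R (AlgebraicClosure K)) := by
      refine mem_center_of_commute_finiteIndex hconn hdense hΔ fun x hx => ?_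
      have e1 := hh ⟨x, hx⟩
      have e2 := hh' ⟨x, hx⟩
      rw [← mul_inv_eq_iff_eq_mul] at e1
      rw [← e1] at e2
      rw [Commute, SemiconjBy, mul_assoc, e2]
      group
    rw [hadj, Subgroup.mem_bot, inv_mul_eq_one] at hc
    exact hc
  -- The equations are the same at all places, so a single rational h accounts for every component.
  have hfinish : ∀ h : Points K R K,
      (∀ (L : Type _) [Field L] [Algebra K L] (x : Points K R L),
        (∀ i : Δ, x * Points.ofBase K R L i = Points.ofBase K R L (φ i) * x) →
        x = Points.ofBase K R L h) → g ∈ (diag ι S).range := by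
    intro h hh
    refine ⟨h, Prod.ext (funext fun v => ?_) (DFunLike.ext _ _ fun v => ?_)⟩
    · exact (hh _ _ (hinf v)).symm
    · exact (hh _ _ (hfin v)).symm
  -- For empty S no place provides a solution, but H_S is trivial.
  rcases S.eq_empty_or_nonempty with rfl | ⟨v | v, hv⟩
  · exact ⟨1, Prod.ext (funext fun v => v.2.elim) (DFunLike.ext _ _ fun v => v.2.elim)⟩
  · obtain ⟨h, hh⟩ := exists_rational_transporter huniq _ (hinf ⟨v, hv⟩)
    exact hfinish h hh
  · obtain ⟨h, hh⟩ := exists_rational_transporter huniq _ (hfin ⟨v, hv⟩)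
    exact hfinish h hh

end Commensurator

end AlgGrp

theorem theoremA6 {K : Type*} [Field K] [NumberField K]
    {R : Type*} [CommRing R] [HopfAlgebra K R] [Algebra.FiniteType K R]
    (hconn : AlgGrp.IsConnectedGroup K R)
    (hss : AlgGrp.IsSemisimple K R)
    (hadj : AlgGrp.IsAdjoint K R)
    {n : ℕ} (ι : AlgGrp.GLEmbedding K R n)
    (S : Set (AlgGrp.Place K))
    (hdense : AlgGrp.IsZariskiDense K R (AlgGrp.sIntegralPoints ι S : Set (AlgGrp.Points K R K))) :
    Subgroup.Commensurable.commensurator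
        ((AlgGrp.sIntegralPoints ι S).map (AlgGrp.diag ι S)) =
      (AlgGrp.diag ι S).range := by
  refine le_antisymm (fun g hg =>
    AlgGrp.mem_range_diag_of_mem_commensurator ι S hconn hadj hdense hg) ?_
  rintro _ ⟨g, rfl⟩
  exact AlgGrp.diag_mem_commensurator ι S g
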